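/- Let $n\ge 0$ and let $G$ be a free metabelian group of rank $n$, i.e. $G\cong F_n/F_n''$, where $F_n$ is the free group of rank $n$ and $F_n''$ its second derived subgroup. Write $[g,h]=g^{-1}h^{-1}gh$, $G'=[G,G]$, $\bar G=G/G'$, and $\bar g=gG'$. The abelian group $G'$ is a module over the integral group ring $\mathbb{Z}\bar G$, written exponentially, in which $\bar g$ acts by $u^{\bar g}=g^{-1}ug$ for $u\in G'$, $g\in G$. Let $z_1,\dots,z_n\in G$. Then $(z_1,\dots,z_n)$ is a basis of $G$ as a free metabelian group (that is, sending the canonical generators of $F_n/F_n''$ to $z_1,\dots,z_n$ defines an isomorphism $F_n/F_n''\to G$) if and only if every $g\in G$ has a unique representation of the form $$ g = z_1^{\gamma_1}\cdots z_n^{\gamma_n}\prod_{1\le j<i\le n}[z_i,z_j]^{\beta_{ij}(\bar z_1,\dots,\bar z_i)}, $$ where $\gamma_1,\dots,\gamma_n\in\mathbb{Z}$, and, for $1\le j<i\le n$, $\beta_{ij}\in\mathbb{Z}[t_1,t_1^{-1},\dots,t_i,t_i^{-1}]$ is a Laurent polynomial and $\beta_{ij}(\bar z_1,\dots,\bar z_i)\in\mathbb{Z}\bar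 G$ is its value at $t_1=\bar z_1,\dots,t_i=\bar z_i$. Uniqueness means that all the integers $\gamma_i$ and all the Laurent polynomials $\beta_{ij}$ are uniquely determined by $g$. -/

import Mathlib

noncomputable section

/-- A group is metabelian if its second derived subgroup is trivial. -/
class IsMetabelian (G : Type*) [Group G] : Prop where
  derivedSeries_two : derivedSeries G 2 = ⊥

/-- The free metabelian group `F / F''`, where `F` is the free group on `ι`. -/
abbrev FreeMetabelianGroup (ι : Type*) : Type _ :=
  FreeGroup ι ⧸ derivedSeries (FreeGroup ι) 2

/-- The canonical generators of the free metabelian group. -/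
def FreeMetabelianGroup.of {ι : Type*} (i : ι) : FreeMetabelianGroup ι :=
  QuotientGroup.mk (FreeGroup.of i)

/-- The family `z` is a basis of `G` as a free metabelian group: sending the `i`-th canonical
generator to `z i` defines an isomorphism from the free metabelian group on `ι` onto `G`. -/
def IsFreeMetabelianBasis {ι G : Type*} [Group G] (z : ι → G) : Prop :=
  ∃ e : FreeMetabelianGroup ι ≃* G, ∀ i, e (FreeMetabelianGroup.of i) = z i

/-- The derived subgroup of a metabelian group is commutative. -/
instance IsMetabelian.commGroupCommutator (G : Type*) [Group G] [IsMetabelian G] :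
    CommGroup (commutator G) where
  mul_comm a b := by
    have h : (a : G) * b * (a : G)⁻¹ * (b : G)⁻¹ ∈ derivedSeries G 2 := by
      rw [derivedSeries_succ, derivedSeries_one]
      exact Subgroup.commutator_mem_commutator a.2 b.2
    rw [IsMetabelian.derivedSeries_two, Subgroup.mem_bot, mul_inv_eq_one, mul_inv_eq_iff_eq_mul] at h
    exact Subtype.ext h

section Action

variable (G : Type*) [Group G] [IsMetabelian G]

/-- The action of the abelianization on the derived subgroup by left conjugation,
`ḡ ↦ (u ↦ g u g⁻¹)`. -/
def derivedConj : Abelianization G →* MulAut (commutator G) :=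
  QuotientGroup.lift (commutator G) MulAut.conjNormal (by
    intro c hc
    rw [MonoidHom.mem_ker]
    ext u
    have h := congrArg Subtype.val (mul_comm (⟨c, hc⟩ : commutator G) u)
    simp only [Subgroup.coe_mul] at h
    simp [MulAut.conjNormal_apply, h])

/-- The action of the abelianization on the derived subgroup, written additively, by right
conjugation: `ḡ ↦ (u ↦ g⁻¹ u g)`. -/
def derivedConjEnd : Abelianization G →* Module.End ℤ (Additive (commutator G)) where
  toFun a := (MonoidHom.toAdditive (derivedConj G a⁻¹).toMonoidHom).toIntLinearMap
  map_one' := by ext; simp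
  map_mul' a b := by
    rw [mul_comm a b, mul_inv_rev]
    ext u
    simp

/-- The `ℤ[G/G']`-module structure on the derived subgroup `G'`, as a ring homomorphism. -/
def derivedAction :
    MonoidAlgebra ℤ (Abelianization G) →ₐ[ℤ] Module.End ℤ (Additive (commutator G)) :=
  MonoidAlgebra.lift ℤ (Module.End ℤ (Additive (commutator G))) (Abelianization G)
    (derivedConjEnd G)

variable {G}

/-- The exponential notation `u ^ a` for `u ∈ G'` and `a ∈ ℤ[G/G']`. -/
def derivedPow (u : commutator G) (a : MonoidAlgebra ℤ (Abelianization G)) : commutator G :=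
  Additive.toMul (derivedAction G a (Additive.ofMul u))

end Action

/-- Laurent polynomials over `R` in the variables `σ`. -/
abbrev MvLaurentPolynomial (σ R : Type*) [CommSemiring R] : Type _ :=
  AddMonoidAlgebra R (σ →₀ ℤ)

/-- The monomial homomorphism `e ↦ ∏ₖ vₖ ^ eₖ` attached to a family of units. -/
def unitMonomial {σ S : Type*} [CommRing S] (v : σ → Sˣ) : Multiplicative (σ →₀ ℤ) →* S where
  toFun e := ((e.toAdd.prod fun k m => v k ^ m : Sˣ) : S)
  map_one' := by simp
  map_mul' e f := by
    rw [← Units.val_mul, toAdd_mul, Finsupp.prod_add_index' (fun _ => zpow_zero _)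
      (fun _ => zpow_add _)]

/-- Evaluation of Laurent polynomials with integer coefficients at a family of units. -/
def MvLaurentPolynomial.eval {σ S : Type*} [CommRing S] (v : σ → Sˣ) :
    MvLaurentPolynomial σ ℤ →ₐ[ℤ] S :=
  AddMonoidAlgebra.lift ℤ S (σ →₀ ℤ) (unitMonomial v)

/-- The image of `g` in `G/G'`, as a unit of the group ring `ℤ[G/G']`. -/
def barUnit {G : Type*} [Group G] (g : G) : (MonoidAlgebra ℤ (Abelianization G))ˣ :=
  Units.map (MonoidAlgebra.of ℤ (Abelianization G)) (toUnits (Abelianization.of g))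

/-- The commutator `[g, h] = g⁻¹ h⁻¹ g h`, as an element of the derived subgroup. -/
def rightCommutator {G : Type*} [Group G] (g h : G) : commutator G :=
  ⟨g⁻¹ * h⁻¹ * g * h, by
    have := Subgroup.commutator_mem_commutator (Subgroup.mem_top g⁻¹) (Subgroup.mem_top h⁻¹)
    simpa [commutatorElement_def, commutator_def] using this⟩

/-- The pairs of indices `(i, j)` with `j < i`. -/
abbrev LowerPair (n : ℕ) : Type := {p : Fin n × Fin n // p.2 < p.1}

/-- Coordinates: integers `γ₁, …, γₙ` and, for each pair `j < i`, a Laurent polynomial `βᵢⱼ` with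
integer coefficients in the variables with indices `k ≤ i`. -/
abbrev NormalFormCoords (n : ℕ) : Type :=
  (Fin n → ℤ) × ((p : LowerPair n) → MvLaurentPolynomial (Set.Iic p.1.1) ℤ)

/-- The element `z₁^γ₁ ⋯ zₙ^γₙ ∏_{j < i} [zᵢ, zⱼ]^{βᵢⱼ(z̄₁, …, z̄ᵢ)}`. -/
def normalFormValue {G : Type*} [Group G] [IsMetabelian G] {n : ℕ} (z : Fin n → G)
    (t : NormalFormCoords n) : G :=
  (List.ofFn fun i => z i ^ t.1 i).prod *
    ((∏ p : LowerPair n, derivedPow (rightCommutator (z p.1.1) (z p.1.2))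
      (MvLaurentPolynomial.eval (fun k : Set.Iic p.1.1 => barUnit (z k)) (t.2 p)) :
        commutator G) : G)

end

/-! Existence holds in any metabelian group generated by the `z i`. Let `N ≤ G'` be generated by the
allowed factors `[zᵢ, zⱼ]^a`, `j < i`, with `a` a Laurent value in `z̄₁, …, z̄ᵢ`. Acting by `z̄ₖ`
with `k ≤ i` keeps `a` allowed; for `k > i` the Hall–Witt identity trades `[zᵢ, zⱼ]^(z̄ₖ - 1)` for
powers of `[zₖ, zⱼ]` and `[zₖ, zᵢ]`, where `z̄ₖ` is allowed. So `N` is normal, `G/N` is abelian, and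
every `g` is an ordered product of powers times an element of `N` (`exists_eq_normalFormValue`).

Uniqueness for the canonical generators (`normalFormValue_of_injective`): the `γᵢ` are read off in
`ℤⁿ`, the `βᵢⱼ` from Fox derivatives via Magnus matrices `(1, d; 0, a)`. Setting `tₘ = 1` for `m >
i` and keeping only the derivative along `xⱼ` isolates `(1 - tᵢ) βᵢⱼ` modulo coefficients already
determined, and the Laurent ring is a domain.

Normal forms are natural under homomorphisms, so the map sending the canonical generators to `z`
matches coordinates: it is bijective exactly when `normalFormValue z` is. -/

noncomputable section

/-! ### Evaluation of Laurent polynomials -/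

namespace MvLaurentPolynomial

variable {σ τ S S' : Type*} [CommRing S] [CommRing S']

theorem eval_single (v : σ → Sˣ) (e : σ →₀ ℤ) (m : ℤ) :
    eval v (AddMonoidAlgebra.single e m) = m • ((e.prod fun k m => v k ^ m : Sˣ) : S) :=
  AddMonoidAlgebra.lift_single _ _ _

/-- The variable `X k`, as a unit of the ring of Laurent polynomials. -/
def unitX (k : σ) : (MvLaurentPolynomial σ ℤ)ˣ :=
  Units.map (AddMonoidAlgebra.of ℤ (σ →₀ ℤ)) (toUnits (Multiplicative.ofAdd (Finsupp.single k 1)))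

theorem coe_unitX_zpow (k : σ) (m : ℤ) :
    ((unitX k ^ m : (MvLaurentPolynomial σ ℤ)ˣ) : MvLaurentPolynomial σ ℤ) =
      AddMonoidAlgebra.single (Finsupp.single k m) 1 := by
  rw [unitX, ← map_zpow, ← map_zpow, ← ofAdd_zsmul]
  simp [AddMonoidAlgebra.of_apply]

theorem coe_unitX (k : σ) : (unitX k : MvLaurentPolynomial σ ℤ) =
    AddMonoidAlgebra.single (Finsupp.single k 1) 1 := by
  simpa using coe_unitX_zpow k 1

theorem eval_unitX_zpow (v : σ → Sˣ) (k : σ) (m : ℤ) :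
    eval v ((unitX k ^ m : (MvLaurentPolynomial σ ℤ)ˣ) : MvLaurentPolynomial σ ℤ) =
      ((v k ^ m : Sˣ) : S) := by
  rw [coe_unitX_zpow, eval_single, Finsupp.prod_single_index (zpow_zero _), one_smul]

theorem ringHom_apply_eq_of_eq_single {f g : MvLaurentPolynomial σ ℤ →+* S}
    (h : ∀ e, f (AddMonoidAlgebra.single e 1) = g (AddMonoidAlgebra.single e 1))
    (b : MvLaurentPolynomial σ ℤ) : f b = g b :=
  DFunLike.congr_fun (AddMonoidAlgebra.ringHom_ext (fun r =>
    DFunLike.congr_fun (Subsingleton.elim (f.comp AddMonoidAlgebra.singleZeroRingHom)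
      (g.comp AddMonoidAlgebra.singleZeroRingHom)) r) h) b

theorem map_eval (F : S →+* S') (v : σ → Sˣ) (b : MvLaurentPolynomial σ ℤ) :
    F (eval v b) = eval (fun k => Units.map (F : S →* S') (v k)) b := by
  refine ringHom_apply_eq_of_eq_single (f := F.comp (eval v).toRingHom)
    (g := (eval _).toRingHom) (fun e => ?_) b
  change F (eval v _) = eval _ _
  rw [eval_single, eval_single, one_smul, one_smul]
  simp only [← map_zpow, ← map_finsuppProd]
  rfl

theorem eval_unitX (b : MvLaurentPolynomial σ ℤ) : eval unitX b = b := by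
  refine ringHom_apply_eq_of_eq_single
    (f := (eval unitX).toRingHom) (g := RingHom.id _) (fun e => ?_) b
  change eval unitX _ = AddMonoidAlgebra.single e 1
  rw [eval_single, one_smul]
  induction e using Finsupp.induction_linear with
  | zero => rfl
  | add e f he hf =>
    rw [Finsupp.prod_add_index' (fun _ => zpow_zero _) (fun _ => zpow_add _), Units.val_mul, he, hf,
      AddMonoidAlgebra.single_mul_single, one_mul]
  | single k m => rw [Finsupp.prod_single_index (zpow_zero _), coe_unitX_zpow]

theorem eval_mapDomain (f : τ → σ) (v : σ → Sˣ) (b : MvLaurentPolynomial τ ℤ) :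
    eval v (AddMonoidAlgebra.mapDomainRingHom ℤ (Finsupp.mapDomain.addMonoidHom f) b) =
      eval (v ∘ f) b := by
  refine ringHom_apply_eq_of_eq_single
    (f := (eval v).toRingHom.comp
      (AddMonoidAlgebra.mapDomainRingHom ℤ (Finsupp.mapDomain.addMonoidHom f)))
    (g := (eval _).toRingHom) (fun e => ?_) b
  change eval v (AddMonoidAlgebra.mapDomain _ _) = eval _ _
  rw [AddMonoidAlgebra.mapDomain_single, eval_single, eval_single,
    Finsupp.mapDomain.addMonoidHom_apply,
    Finsupp.prod_mapDomain_index (fun _ => zpow_zero _) (fun _ => zpow_add _)]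
  rfl

theorem unitX_sub_one_ne_zero (k : σ) :
    (unitX k : MvLaurentPolynomial σ ℤ) - 1 ≠ 0 := by
  rw [coe_unitX, sub_ne_zero, AddMonoidAlgebra.one_def]
  intro h
  have := congrArg (fun p : MvLaurentPolynomial σ ℤ => p.coeff 0) h
  simp at this

end MvLaurentPolynomial

/-! ### The group ring action on the derived subgroup and its naturality -/

section Derived

variable {G H : Type*} [Group G] [Group H]

theorem coe_barUnit (g : G) :
    (barUnit g : MonoidAlgebra ℤ (Abelianization G)) =
      MonoidAlgebra.of ℤ _ (Abelianization.of g) := rfl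

theorem coe_barUnit_inv (g : G) :
    ((barUnit g)⁻¹ : (MonoidAlgebra ℤ (Abelianization G))ˣ) = barUnit g⁻¹ := by
  simp [barUnit]

theorem barUnit_coe (u : commutator G) : barUnit (u : G) = 1 := by
  have : Abelianization.of (u : G) = 1 := (QuotientGroup.eq_one_iff _).2 u.2
  rw [barUnit, this, map_one, map_one]

/-- The map induced on derived subgroups by a homomorphism. -/
def commutatorMap (f : G →* H) : commutator G →* commutator H :=
  (f.comp (commutator G).subtype).codRestrict (commutator H) fun u => by
    have := map_derivedSeries_le_derivedSeries f 1
    rw [derivedSeries_one, derivedSeries_one] at this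
    exact this ⟨u, u.2, rfl⟩

theorem coe_commutatorMap (f : G →* H) (u : commutator G) : (commutatorMap f u : H) = f u := rfl

theorem commutatorMap_rightCommutator (f : G →* H) (g h : G) :
    commutatorMap f (rightCommutator g h) = rightCommutator (f g) (f h) := by
  ext
  simp [coe_commutatorMap, rightCommutator]

theorem map_barUnit (f : G →* H) (g : G) :
    Units.map (MonoidAlgebra.mapDomainRingHom ℤ (Abelianization.map f) :
      MonoidAlgebra ℤ (Abelianization G) →* MonoidAlgebra ℤ (Abelianization H)) (barUnit g) =
      barUnit (f g) := by
  ext1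
  simp [coe_barUnit, MonoidAlgebra.of_apply]

variable [IsMetabelian G] [IsMetabelian H]

theorem derivedPow_zero (u : commutator G) : derivedPow u 0 = 1 := by
  simp [derivedPow]

theorem derivedPow_one (u : commutator G) : derivedPow u 1 = u := by
  simp [derivedPow]

theorem derivedPow_add (u : commutator G) (a b : MonoidAlgebra ℤ (Abelianization G)) :
    derivedPow u (a + b) = derivedPow u a * derivedPow u b := by
  simp [derivedPow]

theorem derivedPow_neg (u : commutator G) (a : MonoidAlgebra ℤ (Abelianization G)) :
    derivedPow u (-a) = (derivedPow u a)⁻¹ := by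
  simp [derivedPow]

theorem derivedPow_sub (u : commutator G) (a b : MonoidAlgebra ℤ (Abelianization G)) :
    derivedPow u (a - b) = derivedPow u a * (derivedPow u b)⁻¹ := by
  rw [sub_eq_add_neg, derivedPow_add, derivedPow_neg]

theorem derivedPow_zsmul (u : commutator G) (m : ℤ) (a : MonoidAlgebra ℤ (Abelianization G)) :
    derivedPow u (m • a) = derivedPow u a ^ m := by
  simp [derivedPow]

theorem derivedPow_mul (u : commutator G) (a b : MonoidAlgebra ℤ (Abelianization G)) :
    derivedPow u (a * b) = derivedPow (derivedPow u b) a := by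
  simp [derivedPow]

/-- The operation `u ↦ u ^ a`, as an endomorphism. -/
def derivedPowHom (a : MonoidAlgebra ℤ (Abelianization G)) : commutator G →* commutator G where
  toFun u := derivedPow u a
  map_one' := by simp [derivedPow]
  map_mul' := by simp [derivedPow]

theorem derivedPowHom_apply (a : MonoidAlgebra ℤ (Abelianization G)) (u : commutator G) :
    derivedPowHom a u = derivedPow u a := rfl

theorem coe_derivedPow_of (u : commutator G) (g : G) :
    (derivedPow u (MonoidAlgebra.of ℤ _ (Abelianization.of g)) : G) = g⁻¹ * u * g := by
  have : derivedAction G (MonoidAlgebra.of ℤ _ (Abelianization.of g)) =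
      derivedConjEnd G (Abelianization.of g) := MonoidAlgebra.lift_of _ _
  rw [derivedPow, this]
  change ((MulAut.conjNormal g⁻¹ u : commutator G) : G) = _
  rw [MulAut.conjNormal_apply, inv_inv]

theorem commutatorMap_derivedPow (f : G →* H) (u : commutator G)
    (a : MonoidAlgebra ℤ (Abelianization G)) :
    commutatorMap f (derivedPow u a) = derivedPow (commutatorMap f u)
      (MonoidAlgebra.mapDomainRingHom ℤ (Abelianization.map f) a) := by
  induction a using MonoidAlgebra.induction_on with
  | of a =>
    obtain ⟨g, rfl⟩ := QuotientGroup.mk_surjective a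
    ext
    change f (derivedPow u (MonoidAlgebra.of ℤ _ (Abelianization.of g))) = _
    have : MonoidAlgebra.mapDomainRingHom ℤ (Abelianization.map f)
        (MonoidAlgebra.of ℤ _ (Abelianization.of g)) =
          MonoidAlgebra.of ℤ _ (Abelianization.of (f g)) := by
      simp [MonoidAlgebra.of_apply]
    erw [this]
    rw [coe_derivedPow_of, coe_derivedPow_of]
    simp [coe_commutatorMap]
  | add a b ha hb => rw [derivedPow_add, map_mul, map_add, derivedPow_add, ha, hb]
  | smul m a ha => rw [derivedPow_zsmul, map_zpow, map_zsmul, derivedPow_zsmul, ha]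

/-- Naturality transports normal forms from the free metabelian group to `G` and to the Magnus
groups without changing the coordinates. -/
theorem map_normalFormValue (f : G →* H) {n : ℕ} (z : Fin n → G) (t : NormalFormCoords n) :
    f (normalFormValue z t) = normalFormValue (fun i => f (z i)) t := by
  rw [normalFormValue, normalFormValue, map_mul, map_list_prod, List.map_ofFn,
    ← coe_commutatorMap, map_prod]
  congr 1
  · simp only [Function.comp_def, map_zpow]
  · simp only [commutatorMap_derivedPow, commutatorMap_rightCommutator,
      MvLaurentPolynomial.map_eval, map_barUnit]

end Derived

/-! ### Existence of normal forms -/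

section Existence

variable {G : Type*} [Group G]

theorem exists_eq_prod_zpow_of_closure_eq_top {n : ℕ} (w : Fin n → G)
    (hw : Subgroup.closure (Set.range w) = ⊤) (hc : ∀ i j, w i * w j = w j * w i) (g : G) :
    ∃ γ : Fin n → ℤ, g = (List.ofFn fun i => w i ^ γ i).prod := by
  have hcomm : ∀ a b : G, a * b = b * a := by
    have := Subgroup.isMulCommutative_closure (k := Set.range w) (by
      rintro _ ⟨i, rfl⟩ _ ⟨j, rfl⟩
      exact hc i j)
    rw [hw] at this
    intro a b
    exact congrArg Subtype.val
      (this.is_comm.comm (⟨a, Subgroup.mem_top a⟩ : (⊤ : Subgroup G)) ⟨b, Subgroup.mem_top b⟩)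
  let _ : CommGroup G := { ‹Group G› with mul_comm := hcomm }
  have hg : g ∈ Subgroup.closure (Set.range w) := hw ▸ Subgroup.mem_top g
  induction hg using Subgroup.closure_induction with
  | mem x hx =>
    obtain ⟨i, rfl⟩ := hx
    refine ⟨Pi.single i 1, ?_⟩
    rw [List.prod_ofFn, Finset.prod_eq_single i] <;> simp +contextual
  | one => exact ⟨0, by simp⟩
  | mul x y _ _ hx hy =>
    obtain ⟨γ, rfl⟩ := hx
    obtain ⟨δ, rfl⟩ := hy
    refine ⟨γ + δ, ?_⟩
    simp only [List.prod_ofFn, Pi.add_apply, zpow_add, Finset.prod_mul_distrib]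
  | inv x _ hx =>
    obtain ⟨γ, rfl⟩ := hx
    refine ⟨-γ, ?_⟩
    simp only [List.prod_ofFn, Pi.neg_apply, zpow_neg, Finset.prod_inv_distrib]

theorem rightCommutator_swap (g h : G) : rightCommutator h g = (rightCommutator g h)⁻¹ := by
  ext
  simp [rightCommutator, mul_assoc]

variable {n : ℕ} (z : Fin n → G)

/-- The values at `z̄` of the Laurent polynomials in the variables with indices `≤ i`. -/
def laurentValues (i : Fin n) : Subalgebra ℤ (MonoidAlgebra ℤ (Abelianization G)) :=
  (MvLaurentPolynomial.eval (fun k : Set.Iic i => barUnit (z k))).range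

theorem laurentValues_mono {i k : Fin n} (h : i ≤ k) : laurentValues z i ≤ laurentValues z k := by
  rintro _ ⟨b, rfl⟩
  exact ⟨_, MvLaurentPolynomial.eval_mapDomain (Set.inclusion (Set.Iic_subset_Iic.2 h)) _ b⟩

theorem barUnit_zpow_mem_laurentValues {i k : Fin n} (h : k ≤ i) (m : ℤ) :
    ((barUnit (z k) ^ m : (MonoidAlgebra ℤ (Abelianization G))ˣ) :
      MonoidAlgebra ℤ (Abelianization G)) ∈ laurentValues z i :=
  ⟨_, MvLaurentPolynomial.eval_unitX_zpow _ (⟨k, h⟩ : Set.Iic i) m⟩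

theorem barUnit_mem_laurentValues {i k : Fin n} (h : k ≤ i) :
    (barUnit (z k) : MonoidAlgebra ℤ (Abelianization G)) ∈ laurentValues z i := by
  simpa using barUnit_zpow_mem_laurentValues z h 1

variable [IsMetabelian G]

theorem rightCommutator_mul_left (a b c : G) :
    rightCommutator (a * b) c =
      derivedPow (rightCommutator a c) (barUnit b) * rightCommutator b c := by
  ext
  rw [Subgroup.coe_mul, coe_barUnit, coe_derivedPow_of]
  simp only [rightCommutator]
  group

theorem rightCommutator_coe_left (u : commutator G) (c : G) :
    rightCommutator (u : G) c = derivedPow u (barUnit c - 1) := by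
  rw [derivedPow_sub, derivedPow_one]
  ext
  rw [mul_comm, Subgroup.coe_mul, coe_barUnit, coe_derivedPow_of]
  simp [rightCommutator, mul_assoc]

/-- The Hall–Witt identity in a metabelian group. -/
theorem derivedPow_rightCommutator_sub_one (a b c : G) :
    derivedPow (rightCommutator a b) (barUnit c - 1) =
      derivedPow (rightCommutator c b) (barUnit a - 1) *
        (derivedPow (rightCommutator c a) (barUnit b - 1))⁻¹ := by
  -- The identity comes from expanding `[ab, c]` in two ways, directly and through `ab = ba[a, b]`;
  -- the factor `[a, b]` acts trivially on `G'`.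
  have h : a * b = b * a * (rightCommutator a b : G) := by
    simp only [rightCommutator]; group
  have h1 := rightCommutator_mul_left a b c
  rw [h, rightCommutator_mul_left, rightCommutator_mul_left, barUnit_coe, Units.val_one,
    derivedPow_one, rightCommutator_coe_left] at h1
  rw [rightCommutator_swap b c, rightCommutator_swap a c]
  simp only [← derivedPowHom_apply, map_inv] at h1 ⊢
  simp only [derivedPowHom_apply, derivedPow_sub, derivedPow_one] at h1 ⊢
  have h2 := eq_inv_mul_of_mul_eq h1
  rw [h2]
  simp only [mul_inv, inv_inv]
  generalize derivedPow (rightCommutator a c) _ = x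
  generalize derivedPow (rightCommutator b c) _ = y
  generalize rightCommutator a c = p
  generalize rightCommutator b c = q
  rw [mul_comm y⁻¹ p⁻¹]
  simp only [mul_comm, mul_left_comm, mul_assoc]

/-- The subgroup of `G'` generated by the factors `[zᵢ, zⱼ] ^ βᵢⱼ(z̄₁, …, z̄ᵢ)`. -/
def normalFormTails : Subgroup (commutator G) :=
  Subgroup.closure {u | ∃ i j, j < i ∧ ∃ a ∈ laurentValues z i,
    u = derivedPow (rightCommutator (z i) (z j)) a}

theorem derivedPow_mem_normalFormTails {i j : Fin n} (h : j < i)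
    {a : MonoidAlgebra ℤ (Abelianization G)} (ha : a ∈ laurentValues z i) :
    derivedPow (rightCommutator (z i) (z j)) a ∈ normalFormTails z :=
  Subgroup.subset_closure ⟨i, j, h, a, ha, rfl⟩

/-- Hall–Witt moves the exponent onto commutators whose larger index is `k`, and for these all of
`a`, `z̄ᵢ`, `z̄ⱼ` are allowed. -/
theorem derivedPow_mul_sub_one_mem_normalFormTails {i j k : Fin n} (hj : j < i) (hk : i < k)
    {a : MonoidAlgebra ℤ (Abelianization G)} (ha : a ∈ laurentValues z k) :
    derivedPow (rightCommutator (z i) (z j)) (a * (barUnit (z k) - 1)) ∈ normalFormTails z := by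
  rw [derivedPow_mul, derivedPow_rightCommutator_sub_one, ← derivedPowHom_apply, map_mul, map_inv,
    derivedPowHom_apply, derivedPowHom_apply, ← derivedPow_mul, ← derivedPow_mul]
  refine mul_mem (derivedPow_mem_normalFormTails z (hj.trans hk) ?_)
    (inv_mem (derivedPow_mem_normalFormTails z hk ?_))
  · exact mul_mem ha (sub_mem (barUnit_mem_laurentValues z hk.le) (one_mem _))
  · exact mul_mem ha (sub_mem (barUnit_mem_laurentValues z (hj.trans hk).le) (one_mem _))

theorem derivedPow_barUnit_mem_normalFormTails (k : Fin n) {u : commutator G}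
    (hu : u ∈ normalFormTails z) : derivedPow u (barUnit (z k)) ∈ normalFormTails z ∧
      derivedPow u (barUnit (z k)⁻¹) ∈ normalFormTails z := by
  suffices h : normalFormTails z ≤ (normalFormTails z).comap (derivedPowHom (barUnit (z k))) ⊓
      (normalFormTails z).comap (derivedPowHom (barUnit (z k)⁻¹)) from h hu
  refine (Subgroup.closure_le _).2 ?_
  rintro _ ⟨i, j, hj, a, ha, rfl⟩
  change derivedPow (derivedPow (rightCommutator (z i) (z j)) a) (barUnit (z k)) ∈
      normalFormTails z ∧
    derivedPow (derivedPow (rightCommutator (z i) (z j)) a) (barUnit (z k)⁻¹) ∈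
      normalFormTails z
  rw [← derivedPow_mul, ← derivedPow_mul]
  have hinv {l : Fin n} (h : k ≤ l) : (barUnit (z k)⁻¹ : MonoidAlgebra ℤ (Abelianization G)) ∈
      laurentValues z l := by
    simpa [coe_barUnit_inv] using barUnit_zpow_mem_laurentValues z h (-1)
  obtain hk | hk := le_or_gt k i
  · exact ⟨derivedPow_mem_normalFormTails z hj (mul_mem (barUnit_mem_laurentValues z hk) ha),
      derivedPow_mem_normalFormTails z hj (mul_mem (hinv hk) ha)⟩
  -- Here `z̄ₖ` is not allowed in the exponent of `[zᵢ, zⱼ]`, so `z̄ₖ^{±1} a` is split as `a` plus a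
  -- multiple of `z̄ₖ - 1`.
  · have ha' := laurentValues_mono z hk.le ha
    have h1 : (barUnit (z k) : MonoidAlgebra ℤ (Abelianization G)) * a =
        a + a * (barUnit (z k) - 1) := by ring
    have h2 : (barUnit (z k)⁻¹ : MonoidAlgebra ℤ (Abelianization G)) * a =
        a - a * barUnit (z k)⁻¹ * (barUnit (z k) - 1) := by
      rw [← coe_barUnit_inv, mul_sub, mul_assoc a, Units.inv_mul]
      ring
    rw [h1, h2, derivedPow_add, derivedPow_sub]
    exact ⟨mul_mem (derivedPow_mem_normalFormTails z hj ha)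
        (derivedPow_mul_sub_one_mem_normalFormTails z hj hk ha'),
      mul_mem (derivedPow_mem_normalFormTails z hj ha)
        (inv_mem (derivedPow_mul_sub_one_mem_normalFormTails z hj hk
          (mul_mem ha' (hinv le_rfl))))⟩

/-- The normalizer contains the generators `zₖ`; its two-sided condition is why stability under both
`z̄ₖ` and `z̄ₖ⁻¹` is needed. -/
theorem normal_map_normalFormTails (hz : Subgroup.closure (Set.range z) = ⊤) :
    ((normalFormTails z).map (commutator G).subtype).Normal := by
  rw [← Subgroup.normalizer_eq_top_iff, eq_top_iff, ← hz, Subgroup.closure_le]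
  rintro _ ⟨k, rfl⟩
  rw [SetLike.mem_coe, Subgroup.mem_normalizer_iff]
  refine fun h => ⟨?_, fun hh => ?_⟩
  · rintro ⟨u, hu, rfl⟩
    refine ⟨_, (derivedPow_barUnit_mem_normalFormTails z k hu).2, ?_⟩
    rw [coe_barUnit, Subgroup.coe_subtype, coe_derivedPow_of, inv_inv]
  · obtain ⟨u, hu, hu'⟩ := hh
    refine ⟨_, (derivedPow_barUnit_mem_normalFormTails z k hu).1, ?_⟩
    rw [Subgroup.coe_subtype] at hu'
    rw [coe_barUnit, Subgroup.coe_subtype, coe_derivedPow_of, hu']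
    group

theorem exists_eq_prod_of_mem_normalFormTails {u : commutator G} (hu : u ∈ normalFormTails z) :
    ∃ b : (p : LowerPair n) → MvLaurentPolynomial (Set.Iic p.1.1) ℤ,
      u = ∏ p : LowerPair n, derivedPow (rightCommutator (z p.1.1) (z p.1.2))
        (MvLaurentPolynomial.eval (fun k : Set.Iic p.1.1 => barUnit (z k)) (b p)) := by
  induction hu using Subgroup.closure_induction with
  | mem x hx =>
    obtain ⟨i, j, hj, _, ⟨b, rfl⟩, rfl⟩ := hx
    refine ⟨Pi.single ⟨(i, j), hj⟩ b, ?_⟩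
    rw [Finset.prod_eq_single ⟨(i, j), hj⟩, Pi.single_eq_same]
    · rfl
    · intro p _ hp
      rw [Pi.single_eq_of_ne hp, map_zero, derivedPow_zero]
    · simp
  | one => exact ⟨0, by simp [derivedPow_zero]⟩
  | mul x y _ _ hx hy =>
    obtain ⟨b, rfl⟩ := hx
    obtain ⟨c, rfl⟩ := hy
    exact ⟨b + c, by simp only [Pi.add_apply, map_add, derivedPow_add, Finset.prod_mul_distrib]⟩
  | inv x _ hx =>
    obtain ⟨b, rfl⟩ := hx
    exact ⟨-b, by simp only [Pi.neg_apply, map_neg, derivedPow_neg, Finset.prod_inv_distrib]⟩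

/-- Every element of a metabelian group generated by `z₁, …, zₙ` has a normal form. -/
theorem exists_eq_normalFormValue (hz : Subgroup.closure (Set.range z) = ⊤) (g : G) :
    ∃ t : NormalFormCoords n, g = normalFormValue z t := by
  have := normal_map_normalFormTails z hz
  set N := (normalFormTails z).map (commutator G).subtype
  have hcomm {i j : Fin n} (h : j < i) : (z i * z j : G ⧸ N) = z j * z i := by
    rw [← QuotientGroup.mk_mul, ← QuotientGroup.mk_mul, eq_comm, QuotientGroup.eq]
    refine ⟨_, derivedPow_mem_normalFormTails z h (one_mem _), ?_⟩
    rw [derivedPow_one]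
    simp [rightCommutator, mul_assoc]
  have hgen : Subgroup.closure (Set.range fun i => (z i : G ⧸ N)) = ⊤ := by
    have h := MonoidHom.map_closure (QuotientGroup.mk' N) (Set.range z)
    rw [hz, Subgroup.map_top_of_surjective _ (QuotientGroup.mk'_surjective N),
      ← Set.range_comp] at h
    exact h.symm
  obtain ⟨γ, hγ⟩ := exists_eq_prod_zpow_of_closure_eq_top (fun i => (z i : G ⧸ N)) hgen
    (fun i j => by
      obtain h | rfl | h := lt_trichotomy i j
      · exact (hcomm h).symm
      · rfl
      · exact hcomm h) (g : G ⧸ N)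
  have hmem : (List.ofFn fun i => z i ^ γ i).prod⁻¹ * g ∈ N := by
    rw [← QuotientGroup.eq, hγ]
    have := map_list_prod (QuotientGroup.mk' N) (List.ofFn fun i => z i ^ γ i)
    rw [List.map_ofFn] at this
    exact this
  obtain ⟨u, hu, hu'⟩ := hmem
  obtain ⟨b, hb⟩ := exists_eq_prod_of_mem_normalFormTails z hu
  refine ⟨(γ, b), ?_⟩
  rw [normalFormValue, ← hb, eq_mul_of_inv_mul_eq hu'.symm]
  rfl

end Existence
-- Universal property of the free metabelian group
theorem derivedSeries_two_le_ker {F H : Type*} [Group F] [Group H] [IsMetabelian H] (f : F →* H) :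
    derivedSeries F 2 ≤ f.ker := by
  rw [← Subgroup.map_eq_bot_iff, eq_bot_iff, ← IsMetabelian.derivedSeries_two]
  exact map_derivedSeries_le_derivedSeries f 2

instance FreeMetabelianGroup.isMetabelian (ι : Type*) : IsMetabelian (FreeMetabelianGroup ι) where
  derivedSeries_two := by
    refine eq_bot_iff.2 ((derivedSeries_le_map_derivedSeries
      (QuotientGroup.mk'_surjective (derivedSeries (FreeGroup ι) 2)) 2).trans ?_)
    rintro _ ⟨x, hx, rfl⟩
    exact (QuotientGroup.eq_one_iff x).2 hx

/-- The universal property of the free metabelian group. -/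
def FreeMetabelianGroup.lift {ι H : Type*} [Group H] [IsMetabelian H] (h : ι → H) :
    FreeMetabelianGroup ι →* H :=
  QuotientGroup.lift _ (FreeGroup.lift h) (derivedSeries_two_le_ker _)

theorem FreeMetabelianGroup.lift_of {ι H : Type*} [Group H] [IsMetabelian H] (h : ι → H) (i : ι) :
    FreeMetabelianGroup.lift h (FreeMetabelianGroup.of i) = h i :=
  FreeGroup.lift_apply_of

theorem FreeMetabelianGroup.closure_range_of (ι : Type*) :
    Subgroup.closure (Set.range (FreeMetabelianGroup.of : ι → FreeMetabelianGroup ι)) = ⊤ := by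
  have h := MonoidHom.map_closure (QuotientGroup.mk' (derivedSeries (FreeGroup ι) 2))
    (Set.range FreeGroup.of)
  rw [FreeGroup.closure_range_of, Subgroup.map_top_of_surjective _
    (QuotientGroup.mk'_surjective _), ← Set.range_comp] at h
  exact h.symm

theorem IsMetabelian.of_comm {G : Type*} [CommGroup G] : IsMetabelian G where
  derivedSeries_two := by
    rw [derivedSeries_succ, derivedSeries_one, eq_bot_iff, Subgroup.commutator_le]
    intro a _ b _
    rw [commutatorElement_def, mul_comm a b, mul_assoc]
    simp

/-! ### Magnus matrices and Fox derivatives -/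

/-- The group of upper triangular matrices with rows `(1, d)` and `(0, a)`, where `a` is a unit. -/
@[ext]
structure MagnusGroup (R : Type*) [CommRing R] where
  /-- the diagonal entry -/
  unit : Rˣ
  /-- the entry off the diagonal -/
  fox : R

namespace MagnusGroup

variable {R : Type*} [CommRing R]

instance : Mul (MagnusGroup R) := ⟨fun g h => ⟨g.unit * h.unit, g.fox * h.unit + h.fox⟩⟩
instance : One (MagnusGroup R) := ⟨⟨1, 0⟩⟩
instance : Inv (MagnusGroup R) := ⟨fun g => ⟨g.unit⁻¹, -(g.fox * (g.unit⁻¹ : Rˣ))⟩⟩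

theorem unit_mul (g h : MagnusGroup R) : (g * h).unit = g.unit * h.unit := rfl
theorem fox_mul (g h : MagnusGroup R) : (g * h).fox = g.fox * h.unit + h.fox := rfl
theorem unit_one : (1 : MagnusGroup R).unit = 1 := rfl
theorem fox_one : (1 : MagnusGroup R).fox = 0 := rfl
theorem unit_inv (g : MagnusGroup R) : g⁻¹.unit = g.unit⁻¹ := rfl
theorem fox_inv (g : MagnusGroup R) : g⁻¹.fox = -(g.fox * (g.unit⁻¹ : Rˣ)) := rfl

instance : Group (MagnusGroup R) :=
  Group.ofLeftAxioms
    (fun a b c => by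
      ext1
      · simp only [unit_mul, mul_assoc]
      · simp only [unit_mul, fox_mul, Units.val_mul]
        ring)
    (fun a => by
      ext1
      · simp only [unit_mul, unit_one, one_mul]
      · simp only [fox_mul, fox_one, zero_mul, zero_add])
    (fun a => by
      ext1
      · simp only [unit_mul, unit_inv, unit_one, inv_mul_cancel]
      · simp only [fox_mul, fox_inv, fox_one]
        rw [neg_mul, mul_assoc, Units.inv_mul, mul_one, neg_add_cancel])

/-- The diagonal entry, as a homomorphism. -/
def unitHom (R : Type*) [CommRing R] : MagnusGroup R →* Rˣ where
  toFun := unit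
  map_one' := rfl
  map_mul' _ _ := rfl

theorem unit_coe_commutator (u : commutator (MagnusGroup R)) : (u : MagnusGroup R).unit = 1 :=
  Abelianization.commutator_subset_ker (unitHom R) u.2

instance : IsMetabelian (MagnusGroup R) where
  derivedSeries_two := by
    rw [derivedSeries_succ, derivedSeries_one, eq_bot_iff, Subgroup.commutator_le]
    intro a ha b hb
    have ha := unit_coe_commutator ⟨a, ha⟩
    have hb := unit_coe_commutator ⟨b, hb⟩
    rw [Subgroup.mem_bot, commutatorElement_eq_one_iff_mul_comm]
    ext1
    · simp only [unit_mul, mul_comm]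
    · simp only [fox_mul] at *
      simp [ha, hb, add_comm]

/-- The off-diagonal entry, as a homomorphism on the derived subgroup. -/
def foxHom (R : Type*) [CommRing R] :
    commutator (MagnusGroup R) →* Multiplicative R where
  toFun u := Multiplicative.ofAdd (u : MagnusGroup R).fox
  map_one' := rfl
  map_mul' u v := by
    rw [Subgroup.coe_mul, fox_mul, unit_coe_commutator, Units.val_one, mul_one, ofAdd_add]

/-- The ring homomorphism from the group ring of the abelianization induced by `unitHom`. -/
def groupRingHom (R : Type*) [CommRing R] :
    MonoidAlgebra ℤ (Abelianization (MagnusGroup R)) →+* R :=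
  (MonoidAlgebra.lift ℤ R (Abelianization (MagnusGroup R))
    ((Units.coeHom R).comp (Abelianization.lift (unitHom R)))).toRingHom

theorem groupRingHom_of (g : MagnusGroup R) :
    groupRingHom R (MonoidAlgebra.of ℤ _ (Abelianization.of g)) = g.unit :=
  MonoidAlgebra.lift_of _ _

theorem map_groupRingHom_barUnit (g : MagnusGroup R) :
    Units.map (groupRingHom R : _ →* R) (barUnit g) = g.unit :=
  Units.ext (groupRingHom_of g)

/-- Elements of the derived subgroup have diagonal entry `1`, so conjugating by `g` just multiplies
the off-diagonal entry by `g.unit`; the rest is additivity. -/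
theorem fox_derivedPow (u : commutator (MagnusGroup R))
    (a : MonoidAlgebra ℤ (Abelianization (MagnusGroup R))) :
    (derivedPow u a : MagnusGroup R).fox = (u : MagnusGroup R).fox * groupRingHom R a := by
  change (foxHom R (derivedPow u a)).toAdd = _
  induction a using MonoidAlgebra.induction_on with
  | of a =>
    obtain ⟨g, rfl⟩ := QuotientGroup.mk_surjective a
    change (derivedPow u (MonoidAlgebra.of ℤ _ (Abelianization.of g)) : MagnusGroup R).fox =
      _ * groupRingHom R (MonoidAlgebra.of ℤ _ (Abelianization.of g))
    rw [coe_derivedPow_of, groupRingHom_of, fox_mul, fox_mul, fox_inv, unit_coe_commutator,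
      Units.val_one, add_mul, mul_one, neg_mul, mul_assoc, Units.inv_mul]
    ring
  | add a b ha hb => rw [derivedPow_add, map_mul, toAdd_mul, ha, hb, map_add, mul_add]
  | smul m a ha => rw [derivedPow_zsmul, map_zpow, toAdd_zpow, ha, map_zsmul, mul_smul_comm]

theorem fox_rightCommutator (g h : MagnusGroup R) :
    (rightCommutator g h : MagnusGroup R).fox =
      g.fox * (h.unit - 1) - h.fox * (g.unit - 1) := by
  change (g⁻¹ * h⁻¹ * g * h).fox = _
  simp only [fox_mul, fox_inv, unit_inv]
  have hg := g.unit.inv_mul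
  have hh := h.unit.inv_mul
  linear_combination (-g.fox * (h.unit⁻¹ : Rˣ) * h.unit) * hg - (g.fox + h.fox * g.unit) * hh

theorem fox_normalFormTail {n : ℕ} (w : Fin n → MagnusGroup R)
    (b : (p : LowerPair n) → MvLaurentPolynomial (Set.Iic p.1.1) ℤ) :
    ((∏ p : LowerPair n, derivedPow (rightCommutator (w p.1.1) (w p.1.2))
      (MvLaurentPolynomial.eval (fun k : Set.Iic p.1.1 => barUnit (w k)) (b p)) :
        commutator (MagnusGroup R)) : MagnusGroup R).fox =
      ∑ p : LowerPair n, ((w p.1.1).fox * ((w p.1.2).unit - 1) -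
        (w p.1.2).fox * ((w p.1.1).unit - 1)) *
          MvLaurentPolynomial.eval (fun k : Set.Iic p.1.1 => (w k).unit) (b p) := by
  change (foxHom R _).toAdd = _
  rw [map_prod, toAdd_prod]
  refine Finset.sum_congr rfl fun p _ => ?_
  change (derivedPow (rightCommutator _ _) _ : commutator (MagnusGroup R)).1.fox = _
  simp only [fox_derivedPow, fox_rightCommutator, MvLaurentPolynomial.map_eval,
    map_groupRingHom_barUnit]

end MagnusGroup

/-! ### Uniqueness of normal forms -/

section Uniqueness

variable {n : ℕ}

theorem exponents_eq_of_normalFormValue_eq {t t' : NormalFormCoords n}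
    (h : normalFormValue (FreeMetabelianGroup.of : Fin n → _) t =
      normalFormValue FreeMetabelianGroup.of t') : t.1 = t'.1 := by
  have := IsMetabelian.of_comm (G := Multiplicative (Fin n → ℤ))
  let f : FreeMetabelianGroup (Fin n) →* Multiplicative (Fin n → ℤ) :=
    FreeMetabelianGroup.lift fun i => Multiplicative.ofAdd (Pi.single i 1)
  have key (t : NormalFormCoords n) :
      f (normalFormValue FreeMetabelianGroup.of t) = Multiplicative.ofAdd t.1 := by
    have hu (u : commutator (FreeMetabelianGroup (Fin n))) : f u = 1 :=
      Abelianization.commutator_subset_ker f u.2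
    rw [normalFormValue, map_mul, hu, mul_one, map_list_prod, List.map_ofFn, List.prod_ofFn]
    simp only [Function.comp_apply, map_zpow, f, FreeMetabelianGroup.lift_of, ← ofAdd_zsmul,
      ← ofAdd_sum]
    congr 1
    ext i
    simp [Finset.sum_apply, Pi.single_apply]
  have h := congrArg f h
  rw [key, key] at h
  exact Multiplicative.ofAdd.injective h

/-- The image of the `m`-th generator in the Magnus group used to read off the coefficient
of `[xᵢ, xⱼ]`: variables with index greater than `i` are specialized to `1`, and only the Fox
derivative with respect to `xⱼ` is kept. -/
def magnusGenerator (i j m : Fin n) : MagnusGroup (MvLaurentPolynomial (Set.Iic i) ℤ) where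
  unit := if h : m ≤ i then MvLaurentPolynomial.unitX ⟨m, h⟩ else 1
  fox := if m = j then 1 else 0

theorem normalFormValue_of_injective :
    Function.Injective (normalFormValue (FreeMetabelianGroup.of : Fin n → _)) := by
  intro t t' h
  have hγ := exponents_eq_of_normalFormValue_eq h
  refine Prod.ext hγ ?_
  -- The smaller index `j` drives the outer induction and `i` the inner one, so all `βₖₗ` with `l <
  -- j`, and `βₖⱼ` with `k < i`, are known to agree.
  suffices ∀ j i : Fin n, ∀ hij : j < i, t.2 ⟨(i, j), hij⟩ = t'.2 ⟨(i, j), hij⟩ from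
    funext fun p => this p.1.2 p.1.1 p.2
  intro j
  induction j using WellFoundedLT.induction with
  | ind j ihj =>
  intro i
  induction i using WellFoundedLT.induction with
  | ind i ihi =>
  intro hij
  have h := congrArg (FreeMetabelianGroup.lift (magnusGenerator i j)) h
  simp only [map_normalFormValue, FreeMetabelianGroup.lift_of] at h
  rw [normalFormValue, normalFormValue, hγ, mul_right_inj] at h
  have h := congrArg MagnusGroup.fox h
  rw [MagnusGroup.fox_normalFormTail, MagnusGroup.fox_normalFormTail, ← sub_eq_zero,
    ← Finset.sum_sub_distrib, Finset.sum_eq_single ⟨(i, j), hij⟩] at h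
  · have hev (b : MvLaurentPolynomial (Set.Iic i) ℤ) :
        MvLaurentPolynomial.eval (fun k : Set.Iic i => (magnusGenerator i j k).unit) b = b := by
      have : (fun k : Set.Iic i => (magnusGenerator i j k).unit) =
          MvLaurentPolynomial.unitX := by
        ext1 k
        exact dif_pos k.2
      rw [this, MvLaurentPolynomial.eval_unitX]
    simp only [hev] at h
    rw [← mul_sub] at h
    -- The surviving cofactor is `1 - Xᵢ`, which is nonzero and can be cancelled in the domain of
    -- Laurent polynomials.
    refine sub_eq_zero.1 ((mul_eq_zero.1 h).resolve_left ?_)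
    have hX := MvLaurentPolynomial.unitX_sub_one_ne_zero (⟨i, le_refl i⟩ : Set.Iic i)
    rw [← neg_ne_zero, neg_sub] at hX
    simpa [magnusGenerator, hij.ne'] using hX
  -- A term survives the `xⱼ`-derivative only if `l = j` or `k = j`. For `l = j`, induction handles
  -- `k < i`, and for `k > i` the factor `tₖ - 1` specializes to `0`; for `k = j`, the outer
  -- induction applies since `l < j`.
  · rintro ⟨⟨k, l⟩, hkl⟩ - hne
    change l < k at hkl
    by_cases hl : l = j
    · subst hl
      obtain hk | rfl | hk := lt_trichotomy k i
      · rw [ihi k hk hkl, sub_self]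
      · exact absurd rfl hne
      · simp [magnusGenerator, hkl.ne', hk.not_ge]
    · by_cases hk : k = j
      · subst hk
        rw [ihj l hkl k hkl, sub_self]
      · simp [magnusGenerator, hl, hk]
  · simp

end Uniqueness

end

theorem mainTheorem5 (n : ℕ) (G : Type*) [Group G] [IsMetabelian G]
    (hG : ∃ x : Fin n → G, IsFreeMetabelianBasis x) (z : Fin n → G) :
    IsFreeMetabelianBasis z ↔
      ∀ g : G, ∃! t : NormalFormCoords n, g = normalFormValue z t := by
  constructor
  · rintro ⟨e, he⟩ g
    have hval (t : NormalFormCoords n) :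
        e (normalFormValue FreeMetabelianGroup.of t) = normalFormValue z t := by
      simpa [he] using map_normalFormValue e.toMonoidHom FreeMetabelianGroup.of t
    obtain ⟨t, ht⟩ := exists_eq_normalFormValue FreeMetabelianGroup.of
      (FreeMetabelianGroup.closure_range_of (Fin n)) (e.symm g)
    refine ⟨t, ?_, fun t' ht' => normalFormValue_of_injective (e.injective ?_)⟩
    · exact (e.apply_symm_apply g).symm.trans ((congrArg e ht).trans (hval t))
    · rw [← ht, hval, e.apply_symm_apply, ht']
  · intro h
    have hval (t : NormalFormCoords n) :
        FreeMetabelianGroup.lift z (normalFormValue FreeMetabelianGroup.of t) =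
          normalFormValue z t := by
      simp only [map_normalFormValue, FreeMetabelianGroup.lift_of]
    refine ⟨MulEquiv.ofBijective (FreeMetabelianGroup.lift z) ⟨fun a b hab => ?_, fun g => ?_⟩,
      FreeMetabelianGroup.lift_of z⟩
    -- Injectivity combines existence of coordinates in the free metabelian group with their
    -- uniqueness in `G`.
    · obtain ⟨s, rfl⟩ := exists_eq_normalFormValue FreeMetabelianGroup.of
        (FreeMetabelianGroup.closure_range_of (Fin n)) a
      obtain ⟨t, rfl⟩ := exists_eq_normalFormValue FreeMetabelianGroup.of
        (FreeMetabelianGroup.closure_range_of (Fin n)) b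
      rw [hval, hval] at hab
      rw [(h _).unique rfl hab]
    · obtain ⟨t, ht, -⟩ := h g
      exact ⟨_, (hval t).trans ht.symm⟩
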